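/- Let $A$ be a real $n\times n$ matrix and let $(A_k)_{k\ge 1}$ be a sequence of entrywise nonnegative real $n\times n$ matrices with $\lim_{k\to\infty}A_k=A$ (entrywise; hence $A$ is also entrywise nonnegative). Suppose that $A$ is reducible, i.e. there is a permutation matrix $P$ such that $$P^{T}AP=\begin{pmatrix}U&V\\0&W\end{pmatrix}$$ with square diagonal blocks $U$ and $W$, each of size at least $1$. For a square matrix $X$ let $\rho(X)=\max\{|\lambda| : \lambda\in\mathbb{C}\text{ is an eigenvalue of }X\}$ denote its spectral radius (for entrywise nonnegative $X$ this is called the Perron root of $X$). Then $$\lim_{k\to\infty}\rho(A_k)=\rho(A).$$ -/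

import Mathlib

/-- A square matrix is reducible if a simultaneous permutation of its rows and columns brings it to
the block triangular form `[U V; 0 W]` with square diagonal blocks `U`, `W` of positive size.
The bijection `e` is the permutation: it lists the indices in their new order, the first `p` of
them belonging to `U` and the last `q` of them to `W`. -/
def IsReducibleMatrix {n : ℕ} (A : Matrix (Fin n) (Fin n) ℝ) : Prop :=
  ∃ (p q : ℕ) (_ : 0 < p) (_ : 0 < q) (e : Fin p ⊕ Fin q ≃ Fin n)
    (U : Matrix (Fin p) (Fin p) ℝ) (V : Matrix (Fin p) (Fin q) ℝ) (W : Matrix (Fin q) (Fin q) ℝ),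
    A.submatrix e e = Matrix.fromBlocks U V 0 W

/-- The Perron root of a (nonnegative) real square matrix: its spectral radius, that is, the maximum
of the moduli of its complex eigenvalues, as a real number. -/
noncomputable def perronRoot {n : ℕ} (A : Matrix (Fin n) (Fin n) ℝ) : ℝ :=
  (spectralRadius ℂ (A.map Complex.ofReal)).toReal

/-- The supremum in the definition of `perronRoot` is finite and attained. -/
theorem perronRoot_isGreatest {n : ℕ} (hn : 0 < n) (A : Matrix (Fin n) (Fin n) ℝ) :
    IsGreatest {t : ℝ | ∃ z ∈ spectrum ℂ (A.map Complex.ofReal), t = ‖z‖} (perronRoot A) := by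
  haveI : Nonempty (Fin n) := ⟨⟨0, hn⟩⟩
  have hne := spectrum.nonempty_of_isAlgClosed_of_finiteDimensional ℂ (A.map Complex.ofReal)
  have hfin : (spectrum ℂ (A.map Complex.ofReal)).Finite := Matrix.finite_spectrum _
  obtain ⟨z, hz, hmax⟩ := hfin.exists_maximalFor (fun z => ‖z‖₊) _ hne
  have hle : ∀ w ∈ spectrum ℂ (A.map Complex.ofReal), ‖w‖₊ ≤ ‖z‖₊ := fun w hw =>
    (le_total ‖w‖₊ ‖z‖₊).elim id (fun h => hmax hw h)
  have heq : spectralRadius ℂ (A.map Complex.ofReal) = (‖z‖₊ : ENNReal) := by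
    unfold spectralRadius
    apply le_antisymm
    · exact iSup₂_le fun w hw => by exact_mod_cast hle w hw
    · exact le_iSup₂ (f := fun (w : ℂ) (_ : w ∈ spectrum ℂ (A.map Complex.ofReal)) =>
        (‖w‖₊ : ENNReal)) z hz
  have hr : perronRoot A = ‖z‖ := by
    unfold perronRoot
    rw [heq]
    simp
  rw [hr]
  refine ⟨⟨z, hz, rfl⟩, ?_⟩
  rintro t ⟨w, hw, rfl⟩
  exact_mod_cast hle w hw

/-! The spectral radius is continuous on all real matrices. Upper bound: the spectrum is upper
hemicontinuous, so it stays in any open disc containing it. Lower bound: at an eigenvalue `z` of `A`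
of maximal modulus, the characteristic polynomial of a nearby `B` is small, so `B` has an eigenvalue
near `z`. -/

open scoped Matrix.Norms.Operator in
/-- The spectral radius of a real matrix is upper semicontinuous. -/
theorem eventually_perronRoot_lt {n : ℕ} (hn : 0 < n) (A : Matrix (Fin n) (Fin n) ℝ) {r : ℝ}
    (hr : perronRoot A < r) : ∀ᶠ B in nhds A, perronRoot B < r := by
  have hmap : Continuous fun B : Matrix (Fin n) (Fin n) ℝ => B.map Complex.ofReal :=
    continuous_id.matrix_map Complex.continuous_ofReal
  have hball : Metric.ball (0 : ℂ) r ∈ nhdsSet (spectrum ℂ (A.map Complex.ofReal)) := by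
    refine Metric.isOpen_ball.mem_nhdsSet.2 fun z hz => ?_
    rw [mem_ball_zero_iff]
    exact ((perronRoot_isGreatest hn A).2 ⟨z, hz, rfl⟩).trans_lt hr
  have hev := upperHemicontinuous_spectrum ℂ (Matrix (Fin n) (Fin n) ℂ)
    (A.map Complex.ofReal) (Metric.ball 0 r) hball
  filter_upwards [hmap.continuousAt.eventually hev] with B hB
  obtain ⟨⟨w, hw, hwB⟩, -⟩ := perronRoot_isGreatest hn B
  rw [hwB, ← mem_ball_zero_iff]
  exact subset_of_mem_nhdsSet hB hw

/-- A point at which the characteristic polynomial is small is close to an eigenvalue. -/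
theorem Matrix.exists_mem_spectrum_norm_sub_lt {n : ℕ} (M : Matrix (Fin n) (Fin n) ℂ) (z : ℂ)
    {ε : ℝ} (hε : 0 < ε) (h : ‖M.charpoly.eval z‖ < ε ^ n) :
    ∃ w ∈ spectrum ℂ M, ‖z - w‖ < ε := by
  have hs : M.charpoly.Splits := IsAlgClosed.splits _
  by_contra! hfar
  refine h.not_ge ?_
  -- The value at `z` is the product of `z - w` over the `n` roots `w`, each factor of norm at least
  -- `ε`.
  rw [hs.eval_eq_prod_roots_of_monic M.charpoly_monic,
    show ‖_‖ = normHom (α := ℂ) _ from rfl, ← Multiset.prod_hom, Multiset.map_map]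
  have hcard : M.charpoly.roots.card = n := by
    rw [← hs.natDegree_eq_card_roots, M.charpoly_natDegree_eq_dim, Fintype.card_fin]
  calc ε ^ n = (M.charpoly.roots.map fun _ => ε).prod := by simp [hcard]
    _ ≤ _ := by
      refine Multiset.prod_map_le_prod_map₀ _ _ (fun _ _ => hε.le) fun w hw => ?_
      exact hfar w (M.mem_spectrum_iff_isRoot_charpoly.2 (Polynomial.isRoot_of_mem_roots hw))

/-- The spectral radius of a real matrix is lower semicontinuous. -/
theorem eventually_lt_perronRoot {n : ℕ} (hn : 0 < n) (A : Matrix (Fin n) (Fin n) ℝ) {r : ℝ}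
    (hr : r < perronRoot A) : ∀ᶠ B in nhds A, r < perronRoot B := by
  obtain ⟨⟨z, hz, hzA⟩, -⟩ := perronRoot_isGreatest hn A
  have hcont : Continuous fun B : Matrix (Fin n) (Fin n) ℝ =>
      ‖(B.map Complex.ofReal).charpoly.eval z‖ := by
    simp only [Matrix.eval_charpoly]
    exact (continuous_const.sub
      (continuous_id.matrix_map Complex.continuous_ofReal)).matrix_det.norm
  -- Any `w` within `perronRoot A - r` of `z` has modulus above `r`.
  have hzero : ‖(A.map Complex.ofReal).charpoly.eval z‖ < (perronRoot A - r) ^ n := by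
    rw [(Matrix.mem_spectrum_iff_isRoot_charpoly.1 hz).eq_zero, norm_zero]
    exact pow_pos (sub_pos.2 hr) n
  filter_upwards [hcont.continuousAt.eventually (gt_mem_nhds hzero)] with B hB
  obtain ⟨w, hw, hzw⟩ := Matrix.exists_mem_spectrum_norm_sub_lt _ z (sub_pos.2 hr) hB
  have hwB : ‖w‖ ≤ perronRoot B := (perronRoot_isGreatest hn B).2 ⟨w, hw, rfl⟩
  have := norm_sub_norm_le z w
  linarith

theorem continuous_perronRoot {n : ℕ} :
    Continuous (perronRoot : Matrix (Fin n) (Fin n) ℝ → ℝ) := by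
  obtain rfl | hn := n.eq_zero_or_pos
  · exact continuous_of_const fun A B => congrArg _ (Subsingleton.elim A B)
  · exact continuous_iff_continuousAt.2 fun A => tendsto_order.2
      ⟨fun _ h => eventually_lt_perronRoot hn A h, fun _ h => eventually_perronRoot_lt hn A h⟩

theorem theorem2 {n : ℕ} (A : ℕ → Matrix (Fin n) (Fin n) ℝ) (Alim : Matrix (Fin n) (Fin n) ℝ)
    (hA : ∀ k i j, 0 ≤ A k i j)
    (hlim : Filter.Tendsto A Filter.atTop (nhds Alim))
    (hred : IsReducibleMatrix Alim) :
    Filter.Tendsto (fun k => perronRoot (A k)) Filter.atTop (nhds (perronRoot Alim)) :=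
  (continuous_perronRoot.tendsto Alim).comp hlim
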